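/- Let $X$, $Y$, $\Theta$ be standard Borel spaces, let $(f_\theta)_{\theta\in\Theta}$ and $(g_\theta)_{\theta\in\Theta}$ be families of probability measures on $X$ and $Y$ respectively, measurable in $\theta$ (i.e. Markov kernels $f:\Theta\to X$ and $g:\Theta\to Y$), and let $m$ be a probability measure on $\Theta$. Let $P\Theta$ be the space of probability measures on $\Theta$, with the $\sigma$-algebra generated by the maps $p\mapsto p(S)$, $S\subseteq\Theta$ measurable. Let $f^\dagger : X\to\Theta$ be a Bayesian inverse of $f$ with respect to $m$, i.e. a Markov kernel with $$\int_S f_\theta(B)\,m(d\theta)=\int_B f^\dagger_x(S)\,(fm)(dx),\qquad fm:=\int_\Theta f_\theta\,m(d\theta),$$ for all measurable $S\subseteq\Theta$, $B\subseteq X$. The standard measure $\hat f_m$ of $f$ is the probability measure on $P\Theta$ that is the image of $fm$ under the measurable map $x\mapsto f^\dagger_x$; it does not depend on the choice of $f^\dagger$. The standard measure $\hat g_m$ is defined in the same way. For probability measures $p,q$ on $P\Theta$, say that $q$ second-order dominates $p$ if there is a $q$-dilation $t$ with $p=tq$, i.e. $p=\int_{P\Theta} t_\pi\,q(d\pi)$.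 Here a $q$-dilation is a Markov kernel $t:P\Theta\to P\Theta$ such that for $q$-almost all $\pi\in P\Theta$ the measure $t_\pi$ has barycenter $\pi$, i.e. $\int_{P\Theta}\rho(S)\,t_\pi(d\rho)=\pi(S)$ for all measurable $S\subseteq\Theta$. Then the following are equivalent: 1. There is a Markov kernel $c:X\to Y$ such that $g_\theta=c f_\theta$, i.e. $g_\theta(B)=\int_X c_x(B)\,f_\theta(dx)$ for all measurable $B\subseteq Y$, holds for $m$-almost all $\theta\in\Theta$. 2. The standard measure $\hat g_m$ second-order dominates the standard measure $\hat f_m$. No finiteness or countability of $\Theta$ is assumed. -/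

import Mathlib

open MeasureTheory ProbabilityTheory

section BlackwellShermanStein

variable {X Θ : Type*} [MeasurableSpace X] [MeasurableSpace Θ]

/-- The measurable map `k♯ : X → P A` associated with a Markov kernel `k` from `X` to `A`.
The space `P A = ProbabilityMeasure A` carries the σ-algebra generated by the evaluations
`p ↦ p S` for measurable `S`. -/
def kernelSharp {A : Type*} [MeasurableSpace A] (k : Kernel X A) [IsMarkovKernel k] (x : X) :
    ProbabilityMeasure A :=
  ⟨k x, inferInstance⟩

theorem measurable_kernelSharp {A : Type*} [MeasurableSpace A] (k : Kernel X A)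
    [IsMarkovKernel k] : Measurable (kernelSharp k) :=
  k.measurable.subtype_mk

/-- The posterior map `(f†)♯ : X → P Θ`, where `f†` is the Bayesian inverse of the experiment `f`
with respect to the prior `m`. -/
noncomputable def posteriorMap [StandardBorelSpace Θ] (f : Kernel Θ X) [IsMarkovKernel f]
    (m : Measure Θ) [IsProbabilityMeasure m] : X → ProbabilityMeasure Θ :=
  haveI : Nonempty Θ := nonempty_of_isProbabilityMeasure m
  kernelSharp (f†m)

theorem measurable_posteriorMap [StandardBorelSpace Θ] (f : Kernel Θ X) [IsMarkovKernel f]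
    (m : Measure Θ) [IsProbabilityMeasure m] : Measurable (posteriorMap f m) :=
  haveI : Nonempty Θ := nonempty_of_isProbabilityMeasure m
  measurable_kernelSharp (f†m)

/-- The standard experiment `f̂ = (f†)♯ ∘ f`, a Markov kernel from `Θ` to `P Θ`. -/
noncomputable def standardExperiment [StandardBorelSpace Θ] (f : Kernel Θ X) [IsMarkovKernel f]
    (m : Measure Θ) [IsProbabilityMeasure m] : Kernel Θ (ProbabilityMeasure Θ) :=
  Kernel.deterministic (posteriorMap f m) (measurable_posteriorMap f m) ∘ₖ f

/-- The standard measure `f̂_m = f̂ ∘ m`, a probability measure on `P Θ`. -/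
noncomputable def standardMeasure [StandardBorelSpace Θ] (f : Kernel Θ X) [IsMarkovKernel f]
    (m : Measure Θ) [IsProbabilityMeasure m] : Measure (ProbabilityMeasure Θ) :=
  standardExperiment f m ∘ₘ m

instance isMarkovKernel_standardExperiment [StandardBorelSpace Θ] (f : Kernel Θ X)
    [IsMarkovKernel f] (m : Measure Θ) [IsProbabilityMeasure m] :
    IsMarkovKernel (standardExperiment f m) := by
  unfold standardExperiment
  infer_instance

instance isProbabilityMeasure_standardMeasure [StandardBorelSpace Θ] (f : Kernel Θ X)
    [IsMarkovKernel f] (m : Measure Θ) [IsProbabilityMeasure m] :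
    IsProbabilityMeasure (standardMeasure f m) := by
  unfold standardMeasure
  infer_instance

/-- The barycenter `S ↦ ∫ p(S) ν(dp)` of a probability measure `ν` on `P Θ`; this is the structure
map `P P Θ → P Θ` of the free algebra `P Θ` of the distribution monad. -/
noncomputable def barycenter (ν : ProbabilityMeasure (ProbabilityMeasure Θ)) :
    ProbabilityMeasure Θ :=
  ⟨(ν : Measure (ProbabilityMeasure Θ)).bind (fun p => (p : Measure Θ)),
    isProbabilityMeasure_bind measurable_subtype_coe.aemeasurable
      (Filter.Eventually.of_forall fun p => p.2)⟩

/-- `t` is a `q`-dilation of `P Θ`: it sends `q`-almost every `p` to a distribution on `P Θ` with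
barycenter `p`. -/
def IsDilation (q : Measure (ProbabilityMeasure Θ))
    (t : Kernel (ProbabilityMeasure Θ) (ProbabilityMeasure Θ)) [IsMarkovKernel t] : Prop :=
  ∀ᵐ p ∂q, barycenter (kernelSharp t p) = p

/-- `q` second-order dominates `p`: some `q`-dilation converts `q` to `p`. -/
def SecondOrderDominates (q p : Measure (ProbabilityMeasure Θ)) : Prop :=
  ∃ (t : Kernel (ProbabilityMeasure Θ) (ProbabilityMeasure Θ)) (_ : IsMarkovKernel t),
    IsDilation q t ∧ p = t ∘ₘ q

end BlackwellShermanStein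

/-!
Bayesian inversion is a symmetric relation between Markov kernels. It reverses composition and
determines each of the two kernels from the other up to null sets. Moreover, if an inverse of `κ`
factors as `η ∘ φ` through a deterministic `φ`, then `η` is an inverse of `φ ∘ κ`. The posterior of
`f` is the posterior map `φ_f : X → P Θ` followed by the sampling kernel `e : P Θ → Θ`, so `e` is
an inverse of every standard experiment.

Given `c` with `g = c ∘ f`, put `t = φ_f ∘ c† ∘ φ_g†`: then `e ∘ t` and `e` are both inverses of the
standard experiment of `g`, hence agree almost everywhere, which says that `t` is a dilation.
Conversely, given a dilation `t`, put `h = t ∘ φ_g` and `c = h† ∘ φ_f`: then `e ∘ h` is an inverse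
of both `g` and `c ∘ f`, hence these agree almost everywhere.
-/

section BayesianInverse

variable {A B C : Type*} [MeasurableSpace A] [MeasurableSpace B] [MeasurableSpace C]

/-- `η` is a Bayesian inverse of `κ` between the laws `μ` and `ν`: drawing `a` from `μ` and then `b`
from `κ a` produces the same joint law as drawing `b` from `ν` and then `a` from `η b`. Keeping `ν`
as a parameter, although it is `κ ∘ₘ μ` for Markov `η`, makes the notion symmetric. It is
meant for s-finite data: `⊗ₘ` is `0` otherwise. -/
def IsBayesianInverse (κ : Kernel A B) (η : Kernel B A) (μ : Measure A) (ν : Measure B) : Prop :=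
  (μ ⊗ₘ κ).map Prod.swap = ν ⊗ₘ η

theorem isBayesianInverse_posterior [StandardBorelSpace A] [Nonempty A] (κ : Kernel A B)
    [IsFiniteKernel κ] (μ : Measure A) [IsFiniteMeasure μ] :
    IsBayesianInverse κ (κ†μ) μ (κ ∘ₘ μ) :=
  compProd_posterior_eq_map_swap.symm

theorem isBayesianInverse_iff_parallelComp {κ : Kernel A B} {η : Kernel B A} {μ : Measure A}
    {ν : Measure B} [SFinite μ] [SFinite ν] :
    IsBayesianInverse κ η μ ν ↔
      (κ ∥ₖ Kernel.id) ∘ₘ Kernel.copy A ∘ₘ μ = (Kernel.id ∥ₖ η) ∘ₘ Kernel.copy B ∘ₘ ν := by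
  have map_swap_compProd :
      (μ ⊗ₘ κ).map Prod.swap = (κ ∥ₖ Kernel.id) ∘ₘ Kernel.copy A ∘ₘ μ := by
    rw [← Measure.swap_comp, Measure.compProd_eq_parallelComp_comp_copy_comp, Measure.comp_assoc,
      Kernel.swap_parallelComp, ← Measure.comp_assoc,
      Measure.comp_assoc (η := Kernel.swap A A), Kernel.swap_copy]
  rw [IsBayesianInverse, map_swap_compProd, Measure.compProd_eq_parallelComp_comp_copy_comp]

namespace IsBayesianInverse

variable {κ κ' : Kernel A B} {η η' : Kernel B A} {μ : Measure A} {ν : Measure B}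

theorem symm (h : IsBayesianInverse κ η μ ν) : IsBayesianInverse η κ ν μ := by
  rw [IsBayesianInverse, ← h, Measure.map_map measurable_swap measurable_swap,
    Prod.swap_swap_eq, Measure.map_id]

theorem comp_eq [SFinite μ] [SFinite ν] [IsSFiniteKernel κ] [IsMarkovKernel η]
    (h : IsBayesianInverse κ η μ ν) : κ ∘ₘ μ = ν := by
  rw [← Measure.snd_compProd, ← Measure.fst_map_swap, h, Measure.fst_compProd]

theorem congr_left [IsSFiniteKernel κ] [IsSFiniteKernel κ'] (h : IsBayesianInverse κ η μ ν)
    (hκ : κ =ᵐ[μ] κ') : IsBayesianInverse κ' η μ ν := by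
  rw [IsBayesianInverse, ← Measure.compProd_congr hκ, h]

theorem congr_right [IsSFiniteKernel η] [IsSFiniteKernel η'] (h : IsBayesianInverse κ η μ ν)
    (hη : η =ᵐ[ν] η') : IsBayesianInverse κ η' μ ν :=
  (h.symm.congr_left hη).symm

theorem ae_eq_right [MeasurableSpace.CountableOrCountablyGenerated B A] [IsFiniteKernel η]
    [IsFiniteKernel η'] [IsFiniteMeasure ν] (h : IsBayesianInverse κ η μ ν)
    (h' : IsBayesianInverse κ η' μ ν) : η =ᵐ[ν] η' :=
  Kernel.ae_eq_of_compProd_eq (Eq.trans (Eq.symm h) h')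

theorem ae_eq_left [MeasurableSpace.CountableOrCountablyGenerated A B] [IsFiniteKernel κ]
    [IsFiniteKernel κ'] [IsFiniteMeasure μ] (h : IsBayesianInverse κ η μ ν)
    (h' : IsBayesianInverse κ' η μ ν) : κ =ᵐ[μ] κ' :=
  h.symm.ae_eq_right h'.symm

theorem comp {κ₂ : Kernel B C} {η₂ : Kernel C B} {ξ : Measure C} [IsSFiniteKernel κ]
    [IsSFiniteKernel η] [IsSFiniteKernel κ₂] [IsSFiniteKernel η₂] [SFinite μ] [SFinite ν]
    [SFinite ξ] (h₂ : IsBayesianInverse κ₂ η₂ ν ξ) (h : IsBayesianInverse κ η μ ν) :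
    IsBayesianInverse (κ₂ ∘ₖ κ) (η ∘ₖ η₂) μ ξ := by
  rw [isBayesianInverse_iff_parallelComp] at h h₂ ⊢
  calc ((κ₂ ∘ₖ κ) ∥ₖ Kernel.id) ∘ₘ Kernel.copy A ∘ₘ μ
    _ = (κ₂ ∥ₖ Kernel.id) ∘ₘ (κ ∥ₖ Kernel.id) ∘ₘ Kernel.copy A ∘ₘ μ := by
      rw [Measure.comp_assoc (η := κ₂ ∥ₖ Kernel.id),
        Kernel.parallelComp_id_right_comp_parallelComp]
    _ = (κ₂ ∥ₖ Kernel.id) ∘ₘ (Kernel.id ∥ₖ η) ∘ₘ Kernel.copy B ∘ₘ ν := by rw [h]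
    _ = (Kernel.id ∥ₖ η) ∘ₘ (κ₂ ∥ₖ Kernel.id) ∘ₘ Kernel.copy B ∘ₘ ν := by
      rw [Measure.comp_assoc, ← Kernel.parallelComp_comm, ← Measure.comp_assoc]
    _ = (Kernel.id ∥ₖ η) ∘ₘ (Kernel.id ∥ₖ η₂) ∘ₘ Kernel.copy C ∘ₘ ξ := by rw [h₂]
    _ = (Kernel.id ∥ₖ (η ∘ₖ η₂)) ∘ₘ Kernel.copy C ∘ₘ ξ := by
      rw [Measure.comp_assoc (η := Kernel.id ∥ₖ η), Kernel.parallelComp_id_left_comp_parallelComp]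

theorem deterministic_comp {η : Kernel C A} {φ : B → C} {hφ : Measurable φ} [IsSFiniteKernel κ]
    [IsSFiniteKernel η] [SFinite μ] [SFinite ν]
    (h : IsBayesianInverse κ (η ∘ₖ Kernel.deterministic φ hφ) μ ν) :
    IsBayesianInverse (Kernel.deterministic φ hφ ∘ₖ κ) η μ (ν.map φ) := by
  rw [isBayesianInverse_iff_parallelComp] at h ⊢
  set d := Kernel.deterministic φ hφ with hd
  calc ((d ∘ₖ κ) ∥ₖ Kernel.id) ∘ₘ Kernel.copy A ∘ₘ μ
    _ = (d ∥ₖ Kernel.id) ∘ₘ (κ ∥ₖ Kernel.id) ∘ₘ Kernel.copy A ∘ₘ μ := by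
      rw [Measure.comp_assoc (η := d ∥ₖ Kernel.id), Kernel.parallelComp_id_right_comp_parallelComp]
    _ = (d ∥ₖ Kernel.id) ∘ₘ (Kernel.id ∥ₖ (η ∘ₖ d)) ∘ₘ Kernel.copy B ∘ₘ ν := by rw [h]
    _ = (Kernel.id ∥ₖ η) ∘ₘ (d ∥ₖ d) ∘ₘ Kernel.copy B ∘ₘ ν := by
      rw [Measure.comp_assoc, Kernel.parallelComp_comp_parallelComp,
        Measure.comp_assoc (η := Kernel.id ∥ₖ η), Kernel.parallelComp_comp_parallelComp,
        Kernel.comp_id, Kernel.id_comp, Kernel.id_comp]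
    -- Determinism enters here: it is what lets `d` commute with copying.
    _ = (Kernel.id ∥ₖ η) ∘ₘ Kernel.copy C ∘ₘ d ∘ₘ ν := by
      rw [Measure.comp_assoc (η := d ∥ₖ d), Kernel.parallelComp_self_comp_copy,
        Measure.comp_assoc (η := Kernel.copy C)]
    _ = (Kernel.id ∥ₖ η) ∘ₘ Kernel.copy C ∘ₘ ν.map φ := by
      rw [hd, Measure.deterministic_comp_eq_map]

end IsBayesianInverse

theorem comp_deterministic_ae_eq_of_ae_eq_map {κ η : Kernel B C} {φ : A → B} (hφ : Measurable φ)
    {μ : Measure A} (h : κ =ᵐ[μ.map φ] η) :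
    κ ∘ₖ Kernel.deterministic φ hφ =ᵐ[μ] η ∘ₖ Kernel.deterministic φ hφ := by
  filter_upwards [ae_of_ae_map hφ.aemeasurable h] with a ha
  rw [Kernel.comp_deterministic_eq_comap, Kernel.comp_deterministic_eq_comap,
    Kernel.comap_apply, Kernel.comap_apply, ha]

end BayesianInverse

section SamplingKernel

variable {Θ : Type*} [MeasurableSpace Θ]

/-- The Markov kernel `P Θ → Θ` that draws a point from the given distribution. Composing a kernel
into `P Θ` with it takes barycenters. -/
def samplingKernel (Θ : Type*) [MeasurableSpace Θ] : Kernel (ProbabilityMeasure Θ) Θ :=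
  ⟨fun p => p, measurable_subtype_coe⟩

instance isMarkovKernel_samplingKernel : IsMarkovKernel (samplingKernel Θ) :=
  ⟨fun p => p.2⟩

theorem isDilation_iff_samplingKernel_comp_ae_eq {q : Measure (ProbabilityMeasure Θ)}
    {t : Kernel (ProbabilityMeasure Θ) (ProbabilityMeasure Θ)} [IsMarkovKernel t] :
    IsDilation q t ↔ samplingKernel Θ ∘ₖ t =ᵐ[q] samplingKernel Θ :=
  Filter.eventually_congr (.of_forall fun _ => Subtype.ext_iff)

end SamplingKernel

section StandardExperiment

variable {X Y Θ : Type*} [MeasurableSpace X] [MeasurableSpace Y] [MeasurableSpace Θ]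
  [StandardBorelSpace Θ]
  (f : Kernel Θ X) [IsMarkovKernel f] (g : Kernel Θ Y) [IsMarkovKernel g]
  (m : Measure Θ) [IsProbabilityMeasure m]

/-- The posterior map `X → P Θ` of an experiment as a deterministic kernel. -/
noncomputable def posteriorMapKernel : Kernel X (ProbabilityMeasure Θ) :=
  Kernel.deterministic (posteriorMap f m) (measurable_posteriorMap f m)

instance isMarkovKernel_posteriorMapKernel : IsMarkovKernel (posteriorMapKernel f m) :=
  Kernel.isMarkovKernel_deterministic _

theorem posteriorMapKernel_comp_eq_standardExperiment :
    posteriorMapKernel f m ∘ₖ f = standardExperiment f m :=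
  rfl

theorem posteriorMapKernel_comp_eq_standardMeasure :
    posteriorMapKernel f m ∘ₘ f ∘ₘ m = standardMeasure f m :=
  Measure.comp_assoc

theorem standardMeasure_eq_map : standardMeasure f m = (f ∘ₘ m).map (posteriorMap f m) := by
  rw [← posteriorMapKernel_comp_eq_standardMeasure, posteriorMapKernel,
    Measure.deterministic_comp_eq_map]

theorem isBayesianInverse_samplingKernel_comp_posteriorMapKernel :
    IsBayesianInverse f (samplingKernel Θ ∘ₖ posteriorMapKernel f m) m (f ∘ₘ m) := by
  have : Nonempty Θ := nonempty_of_isProbabilityMeasure m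
  have hpost : samplingKernel Θ ∘ₖ posteriorMapKernel f m = f†m :=
    Kernel.comp_deterministic_eq_comap _ _
  exact hpost ▸ isBayesianInverse_posterior f m

theorem isBayesianInverse_standardExperiment_samplingKernel :
    IsBayesianInverse (standardExperiment f m) (samplingKernel Θ) m (standardMeasure f m) := by
  rw [standardMeasure_eq_map]
  exact (isBayesianInverse_samplingKernel_comp_posteriorMapKernel f m).deterministic_comp

variable {f g m}

theorem secondOrderDominates_of_garbling [StandardBorelSpace X] [StandardBorelSpace Y]
    {c : Kernel X Y} [IsMarkovKernel c] (hc : g =ᵐ[m] c ∘ₖ f) :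
    SecondOrderDominates (standardMeasure g m) (standardMeasure f m) := by
  have : Nonempty X := nonempty_of_isProbabilityMeasure (f ∘ₘ m)
  have : Nonempty Y := nonempty_of_isProbabilityMeasure (g ∘ₘ m)
  have hcm : c ∘ₘ f ∘ₘ m = g ∘ₘ m := by rw [Measure.comp_assoc, Measure.comp_congr hc]
  let c' := c†(f ∘ₘ m)
  let s := (posteriorMapKernel g m)†(g ∘ₘ m)
  let t := posteriorMapKernel f m ∘ₖ c' ∘ₖ s
  have hc' : IsBayesianInverse c c' (f ∘ₘ m) (g ∘ₘ m) := by
    rw [← hcm]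
    exact isBayesianInverse_posterior c _
  have hs : IsBayesianInverse (posteriorMapKernel g m) s (g ∘ₘ m) (standardMeasure g m) := by
    rw [← posteriorMapKernel_comp_eq_standardMeasure]
    exact isBayesianInverse_posterior _ _
  have hg : IsBayesianInverse g (samplingKernel Θ ∘ₖ posteriorMapKernel f m ∘ₖ c') m (g ∘ₘ m) :=
    (hc'.comp (isBayesianInverse_samplingKernel_comp_posteriorMapKernel f m)).congr_left hc.symm
  have ht : IsBayesianInverse (standardExperiment g m) (samplingKernel Θ ∘ₖ t) m
      (standardMeasure g m) := by
    rw [← posteriorMapKernel_comp_eq_standardExperiment, ← Kernel.comp_assoc, ← Kernel.comp_assoc]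
    exact hs.comp hg
  have htm : t ∘ₘ standardMeasure g m = standardMeasure f m := by
    rw [← Measure.comp_assoc, ← Measure.comp_assoc, hs.symm.comp_eq, hc'.symm.comp_eq,
      posteriorMapKernel_comp_eq_standardMeasure]
  exact ⟨t, inferInstance, isDilation_iff_samplingKernel_comp_ae_eq.2
    (ht.ae_eq_right (isBayesianInverse_standardExperiment_samplingKernel g m)), htm.symm⟩

theorem exists_garbling_of_secondOrderDominates [StandardBorelSpace Y]
    (hdom : SecondOrderDominates (standardMeasure g m) (standardMeasure f m)) :
    ∃ c : Kernel X Y, IsMarkovKernel c ∧ g =ᵐ[m] c ∘ₖ f := by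
  obtain ⟨t, _, hdil, htm⟩ := hdom
  have : Nonempty Y := nonempty_of_isProbabilityMeasure (g ∘ₘ m)
  let h := t ∘ₖ posteriorMapKernel g m
  let c := h†(g ∘ₘ m) ∘ₖ posteriorMapKernel f m
  have hhm : h ∘ₘ g ∘ₘ m = standardMeasure f m := by
    rw [htm, ← posteriorMapKernel_comp_eq_standardMeasure, Measure.comp_assoc (η := t)]
  have hh : IsBayesianInverse h (h†(g ∘ₘ m)) (g ∘ₘ m) (standardMeasure f m) := by
    rw [← hhm]
    exact isBayesianInverse_posterior h _
  have hbary : samplingKernel Θ ∘ₖ h =ᵐ[g ∘ₘ m] samplingKernel Θ ∘ₖ posteriorMapKernel g m := by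
    rw [isDilation_iff_samplingKernel_comp_ae_eq, standardMeasure_eq_map] at hdil
    rw [← Kernel.comp_assoc]
    exact comp_deterministic_ae_eq_of_ae_eq_map (measurable_posteriorMap g m) hdil
  have hg : IsBayesianInverse g (samplingKernel Θ ∘ₖ h) m (g ∘ₘ m) :=
    (isBayesianInverse_samplingKernel_comp_posteriorMapKernel g m).congr_right hbary.symm
  have hcf : IsBayesianInverse (c ∘ₖ f) (samplingKernel Θ ∘ₖ h) m (g ∘ₘ m) := by
    rw [Kernel.comp_assoc, posteriorMapKernel_comp_eq_standardExperiment]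
    exact hh.symm.comp (isBayesianInverse_standardExperiment_samplingKernel f m)
  exact ⟨c, inferInstance, hg.ae_eq_left hcf⟩

end StandardExperiment

theorem mainTheorem4 {X Y Θ : Type*}
    [MeasurableSpace X] [StandardBorelSpace X]
    [MeasurableSpace Y] [StandardBorelSpace Y]
    [MeasurableSpace Θ] [StandardBorelSpace Θ]
    (f : Kernel Θ X) [IsMarkovKernel f]
    (g : Kernel Θ Y) [IsMarkovKernel g]
    (m : Measure Θ) [IsProbabilityMeasure m] :
    (∃ c : Kernel X Y, IsMarkovKernel c ∧ ∀ᵐ θ ∂m, g θ = c ∘ₘ (f θ)) ↔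
      SecondOrderDominates (standardMeasure g m) (standardMeasure f m) :=
  ⟨fun ⟨_, _, hc⟩ => secondOrderDominates_of_garbling hc, exists_garbling_of_secondOrderDominates⟩
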